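/- **Setting.** In the Congested Clique on $n$ vertices, computation proceeds in synchronous rounds; in each round every vertex may send a (possibly different) message of $O(\log n)$ bits to every other vertex, and local computation is free. Let $\mathbb F$ be a finite field whose elements can be represented by $O(\log n)$ bits, i.e. $|\mathbb F|\le n^{c}$ for a constant $c$. Let $\rho=1-2/\sigma$, where $\sigma\ge 2$ is such that for every $d$ there is a bilinear algorithm over $\mathbb F$ that multiplies two $d\times d$ matrices with at most $K d^{\sigma}$ multiplications, for a constant $K$. Given $s$ pairs $(S_i,T_i)_{i\in[s]}$ of $k\times k$ matrices over $\mathbb F$, the vertices have to compute the products $P_i=S_iT_i$. A distribution of the entries of $s$ matrices of size $k\times k$ is a partition of these entries between the $n$ vertices that is known to all vertices; it is *balanced* if every vertex holds at most $n$ entries. **Theorem.** There is a constant $C$, depending only on $c$, $K$ and $\rho$, such that for all integers $n,k,s$ with $|\mathbb F|\le n^{c}$, $\sqrt n\le k\le n$ and $s\le (n/k)^2$ the following hold. 1. Suppose that $n=sq^2$ and $k=qr^2$ for integers $q,r$, and that the vertices are labelled bijectively by the triples $(i,x,y)\in[s]\times[q]\times[q]$. Write each index $a\in[k]$ as $a=a_1a_2a_3$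 with digits $a_1,a_3\in[r]$, $a_2\in[q]$, and let $A[{*}x{*},{*}y{*}]$ be the submatrix of $A$ with the rows $a$ such that $a_2=x$ and the columns $b$ such that $b_2=y$. If the vertex with label $(i,x,y)$ is given $S_i[{*}x{*},{*}y{*}]$ and $T_i[{*}x{*},{*}y{*}]$, then there is a deterministic Congested Clique algorithm after which each vertex with label $(i,x,y)$ knows $P_i[{*}x{*},{*}y{*}]$, and which takes at most $$C\cdot\max\{1,\; n^{\rho-2}\,k^{2}\,s^{1-\rho}\}$$ rounds. 2. More generally, without any divisibility assumption: if the entries of the $S_i$, the entries of the $T_i$ and the entries of the $P_i$ to be output are each distributed in a balanced way (by three arbitrary balanced distributions), then there is a deterministic Congested Clique algorithm that computes all the products $P_i$ within the same number of rounds. -/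

import Mathlib

universe u

/-- A distributed problem on `n` vertices: from a global instance `X`, vertex `v` is given `view v X`
and has to output `goal v X`. -/
structure CliqueProblem (n : ℕ) where
  Inst : Type u
  In : Fin n → Type u
  Out : Fin n → Type u
  view : (v : Fin n) → Inst → In v
  goal : (v : Fin n) → Inst → Out v

/-- A deterministic algorithm for `n` vertices in the Congested Clique with messages of `B` bits.
In round `t` vertex `v` sends to each vertex `w` the message `send v t st w`, which depends only on the
local state `st` of `v`, and then updates its state from the messages that it has received.
Local computation is unrestricted. -/
structure CliqueAlgorithm (n B : ℕ) (In Out : Fin n → Type u) where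
  State : Fin n → Type u
  init : (v : Fin n) → In v → State v
  send : (v : Fin n) → ℕ → State v → Fin n → (Fin B → Bool)
  recv : (v : Fin n) → ℕ → State v → (Fin n → (Fin B → Bool)) → State v
  out : (v : Fin n) → State v → Out v

/-- The local states after `t` synchronous rounds on the local inputs `x`. -/
def CliqueAlgorithm.stateAfter {n B : ℕ} {In Out : Fin n → Type u}
    (A : CliqueAlgorithm n B In Out) (x : (v : Fin n) → In v) : ℕ → (v : Fin n) → A.State v
  | 0 => fun v => A.init v (x v)
  | t + 1 => fun v =>
      A.recv v t (A.stateAfter x t v) (fun w => A.send w t (A.stateAfter x t w) v)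

/-- The problem can be solved in `T` rounds of the Congested Clique, the messages having
`⌈log₂ n⌉` bits. (Messages of `b ⌈log₂ n⌉` bits for a constant `b` save only a factor `b`.) -/
def CliqueProblem.SolvableIn {n : ℕ} (P : CliqueProblem.{u} n) (T : ℕ) : Prop :=
  ∃ A : CliqueAlgorithm n (Nat.clog 2 n) P.In P.Out,
    ∀ (X : P.Inst) (v : Fin n), A.out v (A.stateAfter (fun w => P.view w X) T v) = P.goal v X

/-- The positions of the entries of `s` matrices of size `k × k`: `(i, a, b)` is the entry in row `a`
and column `b` of the `i`-th matrix. -/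
abbrev EntryPos (s k : ℕ) : Type := Fin s × Fin k × Fin k

/-- A partition of the entries of `s` matrices of size `k × k` between `n` vertices: each entry
belongs to exactly one vertex. -/
abbrev EntryLayout (n k s : ℕ) : Type := EntryPos s k → Fin n

/-- Every vertex holds at most `n` entries. -/
def EntryLayout.Balanced {n k s : ℕ} (L : EntryLayout n k s) : Prop :=
  ∀ v : Fin n, Nat.card {e : EntryPos s k // L e = v} ≤ n

/-- The problem of computing the products `P i = S i * T i` of `s` pairs of `k × k` matrices over `F`,
where the entries of the matrices `S i`, `T i` and `P i` are distributed according to `LS`, `LT` and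
`LP`. The three layouts are part of the problem, so they are known to every vertex. -/
def multiProduct (F : Type u) [Field F] {n k s : ℕ} (LS LT LP : EntryLayout n k s) :
    CliqueProblem.{u} n where
  Inst := (Fin s → Matrix (Fin k) (Fin k) F) × (Fin s → Matrix (Fin k) (Fin k) F)
  In v := ({e : EntryPos s k // LS e = v} → F) × ({e : EntryPos s k // LT e = v} → F)
  Out v := {e : EntryPos s k // LP e = v} → F
  view _ X := (fun e => X.1 e.1.1 e.1.2.1 e.1.2.2, fun e => X.2 e.1.1 e.1.2.1 e.1.2.2)
  goal _ X := fun e => (X.1 e.1.1 * X.2 e.1.1) e.1.2.1 e.1.2.2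

/-- For `k = r * q * r`, an index `a < k` is written as `a = a₁ a₂ a₃` with digits `a₁, a₃ < r` and
`a₂ < q`, that is `a = (a₁ * q + a₂) * r + a₃`; this is the digit `a₂`. -/
def midDigit {k q r : ℕ} (hk : k = r * q * r) (a : Fin k) : Fin q :=
  ⟨a.1 / r % q, Nat.mod_lt _ (by
    rcases Nat.eq_zero_or_pos q with h | h
    · have := a.2
      simp [hk, h] at this
    · exact h)⟩

/-- For a labelling of the vertices by triples `(i, x, y)` with `i < s` and `x, y < q`, where
`q = √(n / s)`, the vertex with label `(i, x, y)` holds the submatrix `[*x*, *y*]` of the `i`-th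
matrix, namely the entries whose row index has middle digit `x` and whose column index has middle
digit `y`. -/
def labelLayout {n k s q r : ℕ} (hk : k = r * q * r) (l : Fin n ≃ Fin s × Fin q × Fin q) :
    EntryLayout n k s :=
  fun e => l.symm (e.1, midDigit hk e.2.1, midDigit hk e.2.2)

/-- The problem `Product(Q)`: the vertex with label `(i, x, y)` gets `S i [*x*, *y*]` and
`T i [*x*, *y*]` and has to output `(S i * T i) [*x*, *y*]`. -/
def labelledProduct (F : Type u) [Field F] {n k s q r : ℕ} (hk : k = r * q * r)
    (l : Fin n ≃ Fin s × Fin q × Fin q) : CliqueProblem.{u} n :=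
  multiProduct F (labelLayout hk l) (labelLayout hk l) (labelLayout hk l)

/-- A bilinear algorithm over `F` that multiplies `d × d` matrices with `m` multiplications. -/
structure BilinearAlgorithm (F : Type u) [Field F] (d m : ℕ) where
  α : Fin d → Fin d → Fin m → F
  β : Fin d → Fin d → Fin m → F
  γ : Fin d → Fin d → Fin m → F
  correct : ∀ (S T : Matrix (Fin d) (Fin d) F) (i j : Fin d),
    ∑ w, γ i j w * ((∑ a, ∑ b, α a b w * S a b) * (∑ a, ∑ b, β a b w * T a b)) = (S * T) i j

/-- `ρ` is an exponent of distributed matrix multiplication over `F`, with constant `K`: it is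
`1 - 2 / σ` where `σ ≥ 2` is such that `d × d` matrices over `F` can be multiplied by bilinear
algorithms with at most `K * d ^ σ` multiplications, for every `d`. -/
def IsCliqueMMExponent (F : Type u) [Field F] (K ρ : ℝ) : Prop :=
  ∃ σ : ℝ, 2 ≤ σ ∧ ρ = 1 - 2 / σ ∧
    ∀ d : ℕ, ∃ m : ℕ, (m : ℝ) ≤ K * (d : ℝ) ^ σ ∧ Nonempty (BilinearAlgorithm F d m)

/-- The problem can be solved in at most `R` rounds. -/
def CliqueProblem.SolvableWithin {n : ℕ} (P : CliqueProblem.{u} n) (R : ℝ) : Prop :=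
  ∃ T : ℕ, (T : ℝ) ≤ R ∧ P.SolvableIn T

/-! Local computation is free, so only the flow of information matters: `Learns` tracks which
instances each vertex can tell apart, and `Learns.exists_algorithm` turns such a flow into an
algorithm. By two-hop routing along an edge colouring (`exists_learns_route`), any traffic known in
advance with at most `a * n` field elements into and out of each vertex takes `O(a)` rounds.

Cut each matrix into `d × d` blocks of size `b × b`, with `d ≈ (n / s) ^ (1 / σ)` and `b ≈ k / d`.
The bilinear algorithm then needs about `s * K * d ^ σ ≤ K * n` block multiplications, hence `⌈K⌉₊`
per vertex. Each moves `O(b ^ 2)` field elements, so the cost is `O(1 + b ^ 2 / n)` rounds, and `b ^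
2 / n ≈ n ^ (ρ - 2) * k ^ 2 * s ^ (1 - ρ)` (`multiProduct_solvableIn`, `exists_block_size`). Part 1
is the special case of a balanced layout (`labelLayout_balanced`). -/

/-! ### Knowledge of the vertices -/

section Knowledge

variable {n B : ℕ} {I : Type u}

/-- `Learns B T r r'`: in `T` rounds with messages of `B` bits the vertices can pass from the
knowledge `r` to the knowledge `r'`. The knowledge of a vertex is the equivalence relation of those
instances that it cannot tell apart. -/
inductive Learns (B : ℕ) : ℕ → (Fin n → Setoid I) → (Fin n → Setoid I) → Prop
  | zero (r : Fin n → Setoid I) : Learns B 0 r r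
  | succ {t : ℕ} {r r' : Fin n → Setoid I} (m : Fin n → Fin n → I → (Fin B → Bool))
      (hm : ∀ v w, r v ≤ Setoid.ker (m v w))
      (h : Learns B t (fun v => r v ⊓ Setoid.ker (fun X w => m w v X)) r') : Learns B (t + 1) r r'

theorem Learns.le {T : ℕ} {r r' : Fin n → Setoid I} (h : Learns B T r r') (v : Fin n) :
    r' v ≤ r v := by
  induction h with
  | zero r => exact le_rfl
  | succ m hm h ih => exact ih.trans inf_le_left

theorem Learns.trans {T T' : ℕ} {r r' r'' : Fin n → Setoid I} (h : Learns B T r r')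
    (h' : Learns B T' r' r'') : Learns B (T + T') r r'' := by
  induction h with
  | zero r => simpa using h'
  | succ m hm h ih =>
    have := Learns.succ m hm (ih h')
    rwa [Nat.add_right_comm] at this

/-- Prepend a round, in which `v` sends `m v x w` to `w`, to an algorithm that gets the received
messages as additional inputs. -/
def CliqueAlgorithm.prepend {In Out : Fin n → Type u}
    (m : (v : Fin n) → In v → Fin n → (Fin B → Bool))
    (A : CliqueAlgorithm n B (fun v => In v × (Fin n → (Fin B → Bool))) Out) :
    CliqueAlgorithm n B In Out where
  State v := In v ⊕ A.State v
  init _ x := Sum.inl x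
  -- `A` lags one round behind. In round 0 the state is still `inl`, so the truncation of `t - 1` is
  -- harmless.
  send v t st := Sum.elim (m v) (A.send v (t - 1)) st
  recv v t st msgs := Sum.inr (Sum.elim (fun x => A.init v (x, msgs))
    (fun st' => A.recv v (t - 1) st' msgs) st)
  out v st := Sum.elim (fun x => A.out v (A.init v (x, fun _ _ => false))) (A.out v) st

theorem CliqueAlgorithm.prepend_stateAfter {In Out : Fin n → Type u}
    (m : (v : Fin n) → In v → Fin n → (Fin B → Bool))
    (A : CliqueAlgorithm n B (fun v => In v × (Fin n → (Fin B → Bool))) Out)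
    (x : (v : Fin n) → In v) (t : ℕ) (v : Fin n) :
    (A.prepend m).stateAfter x (t + 1) v =
      Sum.inr (A.stateAfter (fun v => (x v, fun w => m w (x w) v)) t v) := by
  induction t generalizing v with
  | zero => rfl
  | succ t ih =>
    rw [CliqueAlgorithm.stateAfter]
    simp only [ih]
    rfl

/-- A message or output constant on the classes of `ker (view v)` factors through `view v`; off the
range its value is arbitrary. `view` is quantified inside so that the induction can append the
received messages to the input. -/
theorem Learns.exists_algorithm [Nonempty I] {Out : Fin n → Type u}
    {goal : (v : Fin n) → I → Out v} {T : ℕ} {r r' : Fin n → Setoid I} (h : Learns B T r r')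
    (hgoal : ∀ v, r' v ≤ Setoid.ker (goal v)) :
    ∀ {In : Fin n → Type u} (view : (v : Fin n) → I → In v), (∀ v, Setoid.ker (view v) = r v) →
      ∃ A : CliqueAlgorithm n B In Out, ∀ (X : I) (v : Fin n),
        A.out v (A.stateAfter (fun w => view w X) T v) = goal v X := by
  induction h with
  | zero r =>
    intro In view hview
    refine ⟨⟨In, fun _ x => x, fun _ _ _ _ _ => false, fun _ _ st _ => st,
      fun v => Function.extend (view v) (goal v) (fun _ => goal v (Classical.arbitrary I))⟩, ?_⟩
    intro X v
    have hf : (goal v).FactorsThrough (view v) := fun X Y h =>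
      hgoal v ((hview v).le h)
    exact hf.extend_apply (fun _ => goal v (Classical.arbitrary I)) X
  | succ m hm h ih =>
    intro In view hview
    obtain ⟨A, hA⟩ := ih hgoal (fun v X => (view v X, fun w => m w v X)) (by
      intro v
      beta_reduce
      rw [← hview v]
      ext X Y
      simp [Setoid.ker_def, Setoid.inf_iff_and])
    refine ⟨A.prepend fun v x w => Function.extend (view v) (m v w) (fun _ _ => false) x, ?_⟩
    intro X v
    rw [CliqueAlgorithm.prepend_stateAfter]
    have hf : ∀ v w, (m v w).FactorsThrough (view v) := fun v w X Y h =>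
      hm v w ((hview v).le h)
    simp only [(hf _ _).extend_apply]
    exact hA X v

theorem Learns.solvableIn {P : CliqueProblem.{u} n} [Nonempty P.Inst] {T : ℕ}
    {r : Fin n → Setoid P.Inst}
    (h : Learns (Nat.clog 2 n) T (fun v => Setoid.ker (P.view v)) r)
    (hgoal : ∀ v, r v ≤ Setoid.ker (P.goal v)) : P.SolvableIn T :=
  h.exists_algorithm hgoal P.view fun _ => rfl

end Knowledge

/-! ### Sending and routing field elements -/

section Routing

variable {n B : ℕ} {I : Type u}

/-- All messages are determined by the initial knowledge, and knowledge only grows, so they can be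
sent one index `j` per round. -/
theorem exists_learns_bits_fin (T : ℕ) (r : Fin n → Setoid I)
    (φ : Fin T → Fin n → Fin n → I → (Fin B → Bool))
    (h : ∀ j v w, r v ≤ Setoid.ker (φ j v w)) :
    ∃ r', Learns B T r r' ∧ ∀ j v w, r' w ≤ Setoid.ker (φ j v w) := by
  induction T generalizing r with
  | zero => exact ⟨r, .zero r, fun j => j.elim0⟩
  | succ T ih =>
    obtain ⟨r', h1, h2⟩ := ih (fun v => r v ⊓ Setoid.ker (fun X w => φ 0 w v X))
      (fun j => φ j.succ) (fun j v w => inf_le_left.trans (h _ _ _))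
    refine ⟨r', .succ _ (h 0) h1, fun j v w => ?_⟩
    induction j using Fin.cases with
    | zero =>
      intro X Y hXY
      exact congrFun (inf_le_right (a := r w) (h1.le w hXY)) v
    | succ j => exact h2 j v w

theorem exists_learns_bits (J : Type*) [Fintype J] (r : Fin n → Setoid I)
    (φ : J → Fin n → Fin n → I → (Fin B → Bool))
    (h : ∀ j v w, r v ≤ Setoid.ker (φ j v w)) :
    ∃ r', Learns B (Fintype.card J) r r' ∧ ∀ j v w, r' w ≤ Setoid.ker (φ j v w) := by
  obtain ⟨r', h1, h2⟩ := exists_learns_bits_fin (Fintype.card J) r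
    (fun j => φ ((Fintype.equivFin J).symm j)) (fun j => h _)
  exact ⟨r', h1, fun j v w => by simpa using h2 (Fintype.equivFin J j) v w⟩

theorem exists_learns_field {F : Type*} {c : ℕ} (e : F ↪ (Fin c → Fin B → Bool))
    (J : Type*) [Fintype J] (r : Fin n → Setoid I) (φ : J → Fin n → Fin n → I → F)
    (h : ∀ j v w, r v ≤ Setoid.ker (φ j v w)) :
    ∃ r', Learns B (Fintype.card J * c) r r' ∧ ∀ j v w, r' w ≤ Setoid.ker (φ j v w) := by
  obtain ⟨r', h1, h2⟩ := exists_learns_bits (J × Fin c) r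
    (fun j v w X => e (φ j.1 v w X) j.2)
    (fun j v w X Y hXY => congrArg (fun z => e z j.2) (h j.1 v w hXY))
  rw [Fintype.card_prod, Fintype.card_fin] at h1
  exact ⟨r', h1, fun j v w X Y hXY =>
    e.injective (funext fun i => h2 (j, i) v w hXY)⟩

/-- Greedy edge colouring of a bipartite multigraph. -/
theorem exists_edge_colouring {M V : Type*} [Fintype M] {γ : Type*} [Fintype γ] (N : ℕ)
    (hγ : 2 * N ≤ Fintype.card γ) (src dst : M → V)
    (hsrc : ∀ v, Nat.card {m // src m = v} ≤ N) (hdst : ∀ v, Nat.card {m // dst m = v} ≤ N) :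
    ∃ col : M → γ, (∀ m m', src m = src m' → col m = col m' → m = m') ∧
      (∀ m m', dst m = dst m' → col m = col m' → m = m') := by
  classical
  suffices H : ∀ s : Finset M, ∃ col : M → γ, ∀ m ∈ s, ∀ m' ∈ s,
      (src m = src m' ∨ dst m = dst m') → col m = col m' → m = m' by
    obtain ⟨col, h⟩ := H Finset.univ
    exact ⟨col, fun m m' e => h m (Finset.mem_univ _) m' (Finset.mem_univ _) (.inl e),
      fun m m' e => h m (Finset.mem_univ _) m' (Finset.mem_univ _) (.inr e)⟩
  have hcard : ∀ (f : M → V) (x : M) (s : Finset M), Nat.card {m // f m = f x} ≤ N → x ∉ s →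
      (s.filter (fun m => f m = f x)).card + 1 ≤ N := by
    intro f x s h hx
    rw [← Finset.card_insert_of_notMem (a := x) (by simp [hx])]
    refine le_trans (Finset.card_le_card ?_)
      ((Fintype.card_subtype (fun m => f m = f x)).symm.trans_le
        (Nat.card_eq_fintype_card.symm.trans_le h))
    intro m hm
    rcases Finset.mem_insert.1 hm with rfl | hm
    · simp
    · simpa using (Finset.mem_filter.1 hm).2
  intro s
  induction s using Finset.induction_on with
  | empty =>
    rcases isEmpty_or_nonempty M with hM | ⟨⟨x⟩⟩
    · exact ⟨isEmptyElim, by simp⟩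
    -- A single element of `M` already forces `1 ≤ N`.
    · have : 0 < Fintype.card γ := by
        have := hcard src x ∅ (hsrc _) (by simp)
        omega
      obtain ⟨g⟩ := Fintype.card_pos_iff.1 this
      exact ⟨fun _ => g, by simp⟩
  | insert x s hx ih =>
    obtain ⟨col, hcol⟩ := ih
    set bad := s.filter (fun m => src m = src x) ∪ s.filter (fun m => dst m = dst x) with hbad
    -- At most `N - 1` coloured neighbours on either side leave one of the `2 * N` colours free.
    have h1 : (bad.image col).card < Fintype.card γ := by
      have a1 := hcard src x s (hsrc _) hx
      have a2 := hcard dst x s (hdst _) hx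
      have a3 := Finset.card_union_le (s.filter (fun m => src m = src x))
        (s.filter (fun m => dst m = dst x))
      rw [← hbad] at a3
      have a4 := Finset.card_image_le (s := bad) (f := col)
      omega
    obtain ⟨g, hg⟩ : ∃ g, g ∉ bad.image col := by
      by_contra! hall
      have : bad.image col = Finset.univ := Finset.eq_univ_iff_forall.2 hall
      rw [this, Finset.card_univ] at h1
      exact lt_irrefl _ h1
    have key : ∀ m ∈ s, (src m = src x ∨ dst m = dst x) → col m ≠ g := by
      intro m hm h e
      refine hg (Finset.mem_image.2 ⟨m, ?_, e⟩)
      simp only [hbad, Finset.mem_union, Finset.mem_filter]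
      tauto
    have hne : ∀ m ∈ s, m ≠ x := fun m hm e => hx (e ▸ hm)
    refine ⟨Function.update col x g, ?_⟩
    intro m hm m' hm' hadj he
    rcases Finset.mem_insert.1 hm with hm | hm <;> rcases Finset.mem_insert.1 hm' with hm' | hm'
    · rw [hm, hm']
    · rw [hm, Function.update_self, Function.update_of_ne (hne _ hm')] at he
      rw [hm] at hadj
      exact absurd he.symm (key m' hm' (hadj.imp Eq.symm Eq.symm))
    · rw [hm', Function.update_self, Function.update_of_ne (hne _ hm)] at he
      rw [hm'] at hadj
      exact absurd he (key m hm hadj)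
    · rw [Function.update_of_ne (hne _ hm'), Function.update_of_ne (hne _ hm)] at he
      exact hcol m hm m' hm' hadj he

/-- Oblivious routing: if every vertex is the source and the destination of at most `a * n` messages,
then they can be delivered in `4 * a * c` rounds, where a message takes `c * B` bits. -/
theorem exists_learns_route {F : Type*} [Zero F] {c : ℕ} (e : F ↪ (Fin c → Fin B → Bool))
    {M : Type*} [Fintype M] (a : ℕ) (src dst : M → Fin n)
    (hsrc : ∀ v, Nat.card {m // src m = v} ≤ a * n) (hdst : ∀ v, Nat.card {m // dst m = v} ≤ a * n)
    (r : Fin n → Setoid I) (φ : M → I → F) (h : ∀ m, r (src m) ≤ Setoid.ker (φ m)) :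
    ∃ r', Learns B (4 * a * c) r r' ∧ ∀ m, r' (dst m) ≤ Setoid.ker (φ m) := by
  classical
  -- Colour `(j, w)` means: travel in batch `j` via the intermediate vertex `w`. Properness at
  -- sources makes the first hop free of collisions, properness at destinations the second.
  obtain ⟨col, hc1, hc2⟩ := exists_edge_colouring (γ := Fin (2 * a) × Fin n) (a * n)
    (by simp [mul_assoc]) src dst hsrc hdst
  obtain ⟨r1, h1, h1'⟩ := exists_learns_field e (Fin (2 * a)) r
    (fun j v w => if hm : ∃ m, src m = v ∧ col m = (j, w) then φ hm.choose else 0) (by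
      intro j v w
      split_ifs with hm
      · have := h hm.choose
        rwa [hm.choose_spec.1] at this
      · intro X Y _
        rfl)
  have hmid : ∀ m, r1 (col m).2 ≤ Setoid.ker (φ m) := by
    intro m
    have := h1' (col m).1 (src m) (col m).2
    have hm : ∃ m', src m' = src m ∧ col m' = ((col m).1, (col m).2) := ⟨m, rfl, rfl⟩
    rw [dif_pos hm] at this
    rwa [hc1 _ _ hm.choose_spec.1 hm.choose_spec.2] at this
  obtain ⟨r2, h2, h2'⟩ := exists_learns_field e (Fin (2 * a)) r1
    (fun j v w => if hm : ∃ m, dst m = w ∧ col m = (j, v) then φ hm.choose else 0) (by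
      intro j v w
      split_ifs with hm
      · have := hmid hm.choose
        rwa [hm.choose_spec.2] at this
      · intro X Y _
        rfl)
  refine ⟨r2, ?_, fun m => ?_⟩
  · have := h1.trans h2
    rw [Fintype.card_fin] at this
    convert this using 1
    ring
  · have := h2' (col m).1 (col m).2 (dst m)
    have hm : ∃ m', dst m' = dst m ∧ col m' = ((col m).1, (col m).2) := ⟨m, rfl, rfl⟩
    rw [dif_pos hm] at this
    rwa [hc2 _ _ hm.choose_spec.1 hm.choose_spec.2] at this

theorem exists_even_distribution {n : ℕ} (X : Type*) [Fintype X] (g : ℕ)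
    (h : Fintype.card X ≤ g * n) :
    ∃ f : X → Fin n, ∀ v, Nat.card {x // f x = v} ≤ g := by
  obtain ⟨e⟩ := Function.Embedding.nonempty_of_card_le (α := X) (β := Fin g × Fin n) (by simpa)
  refine ⟨fun x => (e x).2, fun v => ?_⟩
  have : Function.Injective (fun x : {x // (e x).2 = v} => (e x.1).1) := by
    rintro ⟨x, hx⟩ ⟨y, hy⟩ hxy
    exact Subtype.ext (e.injective (Prod.ext hxy (hx.trans hy.symm)))
  simpa using Nat.card_le_card_of_injective _ this

/-- The pair `(i m, j m)` determines `m`, so the fibre embeds into a fibre of `f` times `J`. This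
bounds the load of each routing phase. -/
theorem card_fibre_le {M X J V : Type*} [Finite X] [Finite J] {f : X → V} {g N : ℕ}
    (hf : ∀ v, Nat.card {x // f x = v} ≤ g) (i : M → X) (j : M → J)
    (hij : ∀ m m', i m = i m' → j m = j m' → m = m') (hN : g * Nat.card J ≤ N) (v : V) :
    Nat.card {m // f (i m) = v} ≤ N := by
  have : Function.Injective
      (fun m : {m // f (i m) = v} => ((⟨i m.1, m.2⟩ : {x // f x = v}), j m.1)) := by
    rintro ⟨m, hm⟩ ⟨m', hm'⟩ h
    simp only [Prod.mk.injEq, Subtype.mk.injEq] at h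
    exact Subtype.ext (hij _ _ h.1 h.2)
  refine (Nat.card_le_card_of_injective _ this).trans ?_
  rw [Nat.card_prod]
  exact (Nat.mul_le_mul_right _ (hf v)).trans hN

end Routing

/-! ### Block matrix multiplication by a bilinear algorithm -/

section Block

variable {F : Type u} [Field F]

/-- The `κ × κ` matrix with the rows and columns indexed by the image of `ι` that is `S`,
and with zeros elsewhere. -/
noncomputable def padMatrix {k : ℕ} {κ : Type*} (ι : Fin k ↪ κ) (S : Matrix (Fin k) (Fin k) F) :
    Matrix κ κ F :=
  fun u v => Function.extend ι (fun a => Function.extend ι (S a) 0 v) 0 u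

theorem padMatrix_apply {k : ℕ} {κ : Type*} (ι : Fin k ↪ κ) (S : Matrix (Fin k) (Fin k) F)
    (a b : Fin k) : padMatrix ι S (ι a) (ι b) = S a b := by
  rw [padMatrix, ι.injective.extend_apply, ι.injective.extend_apply]

theorem padMatrix_apply_eq_zero_left {k : ℕ} {κ : Type*} (ι : Fin k ↪ κ)
    (S : Matrix (Fin k) (Fin k) F) {u : κ} (hu : u ∉ Set.range ι) (v : κ) :
    padMatrix ι S u v = 0 := by
  rw [padMatrix, Function.extend_apply' _ _ _ hu]
  rfl

theorem padMatrix_apply_eq_zero_right {k : ℕ} {κ : Type*} (ι : Fin k ↪ κ)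
    (S : Matrix (Fin k) (Fin k) F) (u : κ) {v : κ} (hv : v ∉ Set.range ι) :
    padMatrix ι S u v = 0 := by
  by_cases hu : u ∈ Set.range ι
  · obtain ⟨a, rfl⟩ := hu
    rw [padMatrix, ι.injective.extend_apply, Function.extend_apply' _ _ _ hv]
    rfl
  · exact padMatrix_apply_eq_zero_left ι S hu v

theorem padMatrix_mul_apply {k : ℕ} {κ : Type*} [Fintype κ] (ι : Fin k ↪ κ)
    (S T : Matrix (Fin k) (Fin k) F) (a b : Fin k) :
    (padMatrix ι S * padMatrix ι T) (ι a) (ι b) = (S * T) a b := by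
  rw [Matrix.mul_apply, Matrix.mul_apply]
  refine (Fintype.sum_of_injective ι ι.injective _ _ (fun u hu => ?_) (fun c => ?_)).symm
  · rw [padMatrix_apply_eq_zero_left ι T hu, mul_zero]
  · rw [padMatrix_apply, padMatrix_apply]

/-- Padded entries are constantly zero, hence known to every vertex. -/
theorem padMatrix_ker_le {k : ℕ} {κ : Type*} (ι : Fin k ↪ κ) {I : Type*} (r : Setoid I)
    (S : I → Matrix (Fin k) (Fin k) F) (u v : κ)
    (h : ∀ a b, ι a = u → ι b = v → r ≤ Setoid.ker (fun X => S X a b)) :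
    r ≤ Setoid.ker (fun X => padMatrix ι (S X) u v) := by
  intro X Y hXY
  rw [Setoid.ker_def]
  by_cases hu : u ∈ Set.range ι
  · by_cases hv : v ∈ Set.range ι
    · obtain ⟨a, rfl⟩ := hu
      obtain ⟨b, rfl⟩ := hv
      simp only [padMatrix_apply]
      exact h a b rfl rfl hXY
    · simp only [padMatrix_apply_eq_zero_right ι _ u hv]
  · simp only [padMatrix_apply_eq_zero_left ι _ hu]

/-- A bilinear algorithm for `d × d` matrices multiplies block matrices. -/
theorem BilinearAlgorithm.block_correct {d m : ℕ} (A : BilinearAlgorithm F d m) {β : Type*}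
    [Fintype β] (S T : Matrix (Fin d × β) (Fin d × β) F) (u v : Fin d × β) :
    ∑ w, A.γ u.1 v.1 w * ∑ q, (∑ a, ∑ b, A.α a b w * S (a, u.2) (b, q)) *
      (∑ a, ∑ b, A.β a b w * T (a, q) (b, v.2)) = (S * T) u v := by
  -- For each fixed inner offset `q`, the entries at fixed offsets inside the blocks form `d × d`
  -- matrices over `F`, to which `A.correct` applies.
  rw [Finset.sum_congr rfl fun w _ => Finset.mul_sum _ _ _, Finset.sum_comm, Matrix.mul_apply,
    Fintype.sum_prod_type_right]
  exact Finset.sum_congr rfl fun q _ =>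
    A.correct (fun a b => S (a, u.2) (b, q)) (fun a b => T (a, q) (b, v.2)) u.1 v.1

end Block

theorem ker_sum_le {F I J : Type*} [AddCommMonoid F] [Fintype J] {r : Setoid I} {f : J → I → F}
    (h : ∀ j, r ≤ Setoid.ker (f j)) : r ≤ Setoid.ker (fun X => ∑ j, f j X) := fun _ _ hXY =>
  Finset.sum_congr rfl fun j _ => h j hXY

theorem ker_mul_le {F I : Type*} [Mul F] {r : Setoid I} {f g : I → F}
    (hf : r ≤ Setoid.ker f) (hg : r ≤ Setoid.ker g) : r ≤ Setoid.ker (fun X => f X * g X) :=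
  fun _ _ hXY => congrArg₂ _ (hf hXY) (hg hXY)

theorem ker_const_mul_le {F I : Type*} [Mul F] {r : Setoid I} (c : F) {g : I → F}
    (hg : r ≤ Setoid.ker g) : r ≤ Setoid.ker (fun X => c * g X) :=
  fun _ _ hXY => congrArg (c * ·) (hg hXY)

/-- The block algorithm: the `s * m` block multiplications are shared by the `n` vertices, each of
which performs at most `N` of them. -/
theorem multiProduct_solvableIn {F : Type u} [Field F] {n k s d b m c N : ℕ}
    (e : F ↪ (Fin c → Fin (Nat.clog 2 n) → Bool)) (A : BilinearAlgorithm F d m)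
    (hn : 0 < n) (hs : 0 < s) (hkdb : k ≤ d * b) (hsm : s * m ≤ N * n)
    (hd : (s * (b * b) / n + 1) * (d * d) ≤ 5 * n)
    {LS LT LP : EntryLayout n k s} (hLS : LS.Balanced) (hLT : LT.Balanced) (hLP : LP.Balanced) :
    (multiProduct F LS LT LP).SolvableIn (4 * c * (15 + 3 * (N * (b * b / n + 2)))) := by
  classical
  obtain ⟨ι⟩ := Function.Embedding.nonempty_of_card_le (α := Fin k) (β := Fin d × Fin b) (by simpa)
  -- The vertex `pos (i, x, y)` collects the entry at offset `(x, y)` of every block of matrix `i`,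
  -- so it can form all `m` linear combinations at that offset locally.
  obtain ⟨pos, hpos⟩ := exists_even_distribution (n := n) (Fin s × Fin b × Fin b)
    (s * (b * b) / n + 1) (by
      simp only [Fintype.card_prod, Fintype.card_fin]
      rw [mul_comm _ n]
      exact (Nat.lt_mul_div_succ _ hn).le)
  obtain ⟨mul, hmul⟩ := exists_even_distribution (n := n) (Fin s × Fin m) N (by simpa)
  -- In `+ 2`, one unit rounds `b * b / n` up; the other pays for the rounding in the load of `pos`.
  set G := N * (b * b / n + 2) with hG
  have hbb : b * b ≤ n * (b * b / n + 1) := (Nat.lt_mul_div_succ _ hn).le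
  have hmN : m ≤ N * n := (Nat.le_mul_of_pos_left m hs).trans hsm
  have hcount_pos : (s * (b * b) / n + 1) * m ≤ G * n := by
    have h1 : s * (b * b) / n * m ≤ N * (b * b) := by
      refine Nat.le_of_mul_le_mul_right (c := n) ?_ hn
      calc s * (b * b) / n * m * n = s * (b * b) / n * n * m := by ring
        _ ≤ s * (b * b) * m := Nat.mul_le_mul_right _ (Nat.div_mul_le_self _ _)
        _ = s * m * (b * b) := by ring
        _ ≤ N * n * (b * b) := Nat.mul_le_mul_right _ hsm
        _ = N * (b * b) * n := by ring
    calc (s * (b * b) / n + 1) * m = s * (b * b) / n * m + m := by ring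
      _ ≤ N * (n * (b * b / n + 1)) + N * n := by exact Nat.add_le_add (h1.trans (Nat.mul_le_mul_left _ hbb)) hmN
      _ = G * n := by rw [hG]; ring
  have hcount_mul : N * (b * b) ≤ G * n := by
    calc N * (b * b) ≤ N * (n * (b * b / n + 1)) := by gcongr
      _ ≤ N * (n * (b * b / n + 2)) := by gcongr; omega
      _ = G * n := by rw [hG]; ring
  have hbal : ∀ {L : EntryLayout n k s}, L.Balanced → ∀ v, Nat.card {x // L x = v} ≤ 5 * n :=
    fun hL v => (hL v).trans (by omega)
  have hpos_entry : ∀ v, Nat.card {x : EntryPos s k //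
      pos (x.1, (ι x.2.1).2, (ι x.2.2).2) = v} ≤ 5 * n :=
    card_fibre_le (J := Fin d × Fin d) hpos
      (fun x : EntryPos s k => (x.1, (ι x.2.1).2, (ι x.2.2).2))
      (fun x => ((ι x.2.1).1, (ι x.2.2).1)) (by
        rintro ⟨i, a, a'⟩ ⟨i', c, c'⟩ h h'
        simp only [Prod.mk.injEq] at h h'
        rw [h.1, ι.injective (Prod.ext h'.1 h.2.1), ι.injective (Prod.ext h'.2 h.2.2)])
      (by simpa using hd)
  have hpos_block : ∀ v, Nat.card {x : Fin s × Fin m × Fin b × Fin b //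
      pos (x.1, x.2.2) = v} ≤ G * n :=
    card_fibre_le (J := Fin m) hpos (fun x : Fin s × Fin m × Fin b × Fin b => (x.1, x.2.2))
      (fun x => x.2.1) (by
        rintro ⟨i, a, a'⟩ ⟨i', c, c'⟩ h h'
        simp only [Prod.mk.injEq] at h h'
        rw [h.1, h.2, h']) (by simpa using hcount_pos)
  have hmul_block : ∀ v, Nat.card {x : Fin s × Fin m × Fin b × Fin b //
      mul (x.1, x.2.1) = v} ≤ G * n :=
    card_fibre_le (J := Fin b × Fin b) hmul
      (fun x : Fin s × Fin m × Fin b × Fin b => (x.1, x.2.1)) (fun x => x.2.2) (by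
        rintro ⟨i, a, a'⟩ ⟨i', c, c'⟩ h h'
        simp only [Prod.mk.injEq] at h h'
        rw [h.1, h.2, h']) (by simpa using hcount_mul)
  let I := (Fin s → Matrix (Fin k) (Fin k) F) × (Fin s → Matrix (Fin k) (Fin k) F)
  let U : Fin s × Fin m × Fin b × Fin b → I → F := fun x X =>
    ∑ y, ∑ z, A.α y z x.2.1 * padMatrix ι (X.1 x.1) (y, x.2.2.1) (z, x.2.2.2)
  let V : Fin s × Fin m × Fin b × Fin b → I → F := fun x X =>
    ∑ y, ∑ z, A.β y z x.2.1 * padMatrix ι (X.2 x.1) (y, x.2.2.1) (z, x.2.2.2)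
  let W : Fin s × Fin m × Fin b × Fin b → I → F := fun x X =>
    ∑ q, U (x.1, x.2.1, x.2.2.1, q) X * V (x.1, x.2.1, q, x.2.2.2) X
  let P : EntryPos s k → I → F := fun x X => (X.1 x.1 * X.2 x.1) x.2.1 x.2.2
  have hP : ∀ x X, P x X = ∑ w, A.γ (ι x.2.1).1 (ι x.2.2).1 w *
      W (x.1, w, (ι x.2.1).2, (ι x.2.2).2) X := fun x X => by
    change (X.1 x.1 * X.2 x.1) x.2.1 x.2.2 = _
    rw [← padMatrix_mul_apply ι, ← A.block_correct]
  -- the entries are collected at the vertices responsible for their positions in the blocks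
  obtain ⟨r₁, l₁, h₁⟩ := exists_learns_route e 5 LS _ (hbal hLS) hpos_entry
    (fun v => Setoid.ker ((multiProduct F LS LT LP).view v))
    (fun (x : EntryPos s k) (X : I) => X.1 x.1 x.2.1 x.2.2)
    (fun x X Y h => congrFun (congrArg Prod.fst h) (⟨x, rfl⟩ : {y // LS y = LS x}))
  obtain ⟨r₂, l₂, h₂⟩ := exists_learns_route e 5 LT _ (hbal hLT) hpos_entry r₁
    (fun (x : EntryPos s k) (X : I) => X.2 x.1 x.2.1 x.2.2)
    (fun x => (l₁.le _).trans fun X Y h =>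
      congrFun (congrArg Prod.snd h) (⟨x, rfl⟩ : {y // LT y = LT x}))
  -- the factors of the block multiplications
  have hU : ∀ x, r₂ (pos (x.1, x.2.2)) ≤ Setoid.ker (U x) := fun x =>
    ker_sum_le fun y => ker_sum_le fun z => ker_const_mul_le _ <|
      padMatrix_ker_le ι _ _ _ _ fun a a' ha ha' => by
        have := (l₂.le _).trans (h₁ (x.1, a, a'))
        simp only [ha, ha'] at this
        exact this
  have hV : ∀ x, r₂ (pos (x.1, x.2.2)) ≤ Setoid.ker (V x) := fun x =>
    ker_sum_le fun y => ker_sum_le fun z => ker_const_mul_le _ <|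
      padMatrix_ker_le ι _ _ _ _ fun a a' ha ha' => by
        have := h₂ (x.1, a, a')
        simp only [ha, ha'] at this
        exact this
  obtain ⟨r₃, l₃, h₃⟩ := exists_learns_route e G _ _ hpos_block hmul_block r₂ U hU
  obtain ⟨r₄, l₄, h₄⟩ := exists_learns_route e G _ _ hpos_block hmul_block r₃ V
    (fun x => (l₃.le _).trans (hV x))
  -- the block products are sent back, and the entries of the products to their destinations
  obtain ⟨r₅, l₅, h₅⟩ := exists_learns_route e G _ _ hmul_block hpos_block r₄ W
    (fun x => ker_sum_le fun q => ker_mul_le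
      ((l₄.le _).trans (h₃ (x.1, x.2.1, x.2.2.1, q))) (h₄ (x.1, x.2.1, q, x.2.2.2)))
  obtain ⟨r₆, l₆, h₆⟩ := exists_learns_route e 5 _ LP hpos_entry (hbal hLP) r₅ P (fun x => by
    rw [funext (hP x)]
    exact ker_sum_le fun w => ker_const_mul_le _ (h₅ (x.1, w, (ι x.2.1).2, (ι x.2.2).2)))
  -- Three phases move entries of `S`, `T` and the products; three move the blocks `U`, `V` and `W`.
  have hT : 4 * c * (15 + 3 * G) = 4 * 5 * c + 4 * 5 * c + 4 * G * c + 4 * G * c + 4 * G * c +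
      4 * 5 * c := by ring
  rw [hT]
  have : Nonempty (multiProduct F LS LT LP).Inst := ⟨((fun _ => 0, fun _ => 0) : I)⟩
  refine Learns.solvableIn (((((l₁.trans l₂).trans l₃).trans l₄).trans l₅).trans l₆) ?_
  intro v X Y hXY
  funext x
  have := h₆ x.1
  rw [x.2] at this
  exact this hXY

/-! ### The layout of the labelled problem is balanced -/

theorem midDigit_injective {k q r : ℕ} (hk : k = r * q * r) {a a' : Fin k}
    (h₁ : a.1 / r / q = a'.1 / r / q) (h₂ : midDigit hk a = midDigit hk a')
    (h₃ : a.1 % r = a'.1 % r) : a = a' := by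
  have h₂' : a.1 / r % q = a'.1 / r % q := congrArg Fin.val h₂
  have h₄ : a.1 / r = a'.1 / r := by
    rw [← Nat.div_add_mod (a.1 / r) q, ← Nat.div_add_mod (a'.1 / r) q, h₁, h₂']
  apply Fin.ext
  rw [← Nat.div_add_mod a.1 r, ← Nat.div_add_mod a'.1 r, h₄, h₃]

/-- The label fixes the matrix and both middle digits, so the four outer digits identify an entry:
at most `r ^ 4` per vertex, and `n * r ^ 4 = s * k ^ 2 ≤ n ^ 2`. -/
theorem labelLayout_balanced {n k s q r : ℕ} (hk : k = r * q * r)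
    (l : Fin n ≃ Fin s × Fin q × Fin q) (hsk : s * k ^ 2 ≤ n ^ 2) :
    (labelLayout hk l).Balanced := by
  intro v
  have hn : n = s * (q * q) := by simpa using Fintype.card_congr l
  have hr : r * r * (r * r) ≤ n := by
    refine (Nat.mul_le_mul_left_iff v.pos).1 ?_
    calc n * (r * r * (r * r)) = s * k ^ 2 := by rw [hk, hn]; ring
      _ ≤ n * n := by rwa [← sq]
  have hlt : ∀ a : Fin k, a.1 / r / q < r ∧ a.1 % r < r := by
    intro a
    have ha : a.1 < r * q * r := lt_of_lt_of_eq a.2 hk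
    refine ⟨?_, Nat.mod_lt _ (Nat.pos_of_ne_zero fun h => by simp [h] at ha)⟩
    rw [Nat.div_div_eq_div_mul]
    exact Nat.div_lt_of_lt_mul ha
  let D : Fin k → Fin r × Fin r := fun a => (⟨_, (hlt a).1⟩, ⟨_, (hlt a).2⟩)
  have hinj : Function.Injective (fun e : {e : EntryPos s k // labelLayout hk l e = v} =>
      (D e.1.2.1, D e.1.2.2)) := by
    rintro ⟨⟨i, a, b⟩, he⟩ ⟨⟨i', a', b'⟩, he'⟩ h
    have hl := l.symm.injective (he.trans he'.symm)
    simp only [Prod.mk.injEq, D, Fin.mk.injEq] at hl h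
    obtain ⟨rfl, h₁, h₂⟩ := hl
    obtain ⟨⟨ha, ha'⟩, hb, hb'⟩ := h
    obtain rfl := midDigit_injective hk ha h₁ ha'
    obtain rfl := midDigit_injective hk hb h₂ hb'
    rfl
  refine (Nat.card_le_card_of_injective _ hinj).trans ?_
  simpa using hr

/-! ### The choice of the block size -/

theorem exists_block_size {n k s : ℕ} {σ : ℝ} (hσ : 2 ≤ σ) (hs : 0 < s) (hk : 0 < k)
    (hnk : n ≤ k ^ 2) (hsn : s ≤ n) (hsk : s * k ^ 2 ≤ n ^ 2) :
    ∃ d b : ℕ, k ≤ d * b ∧ (s : ℝ) * (d : ℝ) ^ σ ≤ n ∧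
      (s * (b * b) / n + 1) * (d * d) ≤ 5 * n ∧
      ((b * b / n : ℕ) : ℝ) ≤
        16 * ((n : ℝ) ^ (1 - 2 / σ - 2) * (k : ℝ) ^ 2 * (s : ℝ) ^ (1 - (1 - 2 / σ))) := by
  have hn : 0 < n := hs.trans_le hsn
  have hs' : (0 : ℝ) < s := by exact_mod_cast hs
  have hn' : (0 : ℝ) < n := by exact_mod_cast hn
  have hσ0 : 0 < σ := by linarith
  have hns : (1 : ℝ) ≤ (n : ℝ) / s := by
    rw [one_le_div hs']
    exact_mod_cast hsn
  set x : ℝ := ((n : ℝ) / s) ^ (1 / σ) with hx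
  have hx1 : 1 ≤ x := Real.one_le_rpow hns (by positivity)
  have hxσ : x ^ σ = n / s := by
    rw [hx, ← Real.rpow_mul (by positivity), one_div_mul_cancel hσ0.ne', Real.rpow_one]
  have hx2 : x ^ 2 = ((n : ℝ) / s) ^ (2 / σ) := by
    rw [hx, ← Real.rpow_natCast, ← Real.rpow_mul (by positivity)]
    congr 1
    push_cast
    ring
  -- Here `2 ≤ σ` enters; it yields `s * d ^ 2 ≤ n`, and so `d ≤ k`.
  have hx2' : x ^ 2 ≤ n / s := by
    rw [hx2]
    refine (Real.rpow_le_rpow_of_exponent_le hns ?_).trans_eq (Real.rpow_one _)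
    rwa [div_le_one hσ0]
  set d := ⌊x⌋₊ with hd
  have hd1 : 1 ≤ d := Nat.le_floor (by simpa using hx1)
  have hdx : (d : ℝ) ≤ x := Nat.floor_le (by linarith)
  have hsd : s * (d * d) ≤ n := by
    have : (s : ℝ) * ((d : ℝ) * d) ≤ n := by
      rw [mul_comm, ← le_div_iff₀ hs', ← sq]
      exact (pow_le_pow_left₀ (by positivity) hdx 2).trans hx2'
    exact_mod_cast this
  have hdd : d * d ≤ n := (Nat.le_mul_of_pos_left _ hs).trans hsd
  have hdk : d ≤ k := by
    rw [← Nat.pow_le_pow_iff_left two_ne_zero, sq]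
    exact hdd.trans hnk
  have hdb : d * (k / d + 1) ≤ 2 * k := by
    have := Nat.mul_div_le k d
    rw [mul_add, mul_one]
    omega
  refine ⟨d, k / d + 1, (Nat.lt_mul_div_succ _ hd1).le, ?_, ?_, ?_⟩
  · rw [mul_comm, ← le_div_iff₀ hs', ← hxσ]
    exact Real.rpow_le_rpow (by positivity) hdx hσ0.le
  · set b := k / d + 1
    have h1 : s * (b * b) / n * (d * d) ≤ 4 * n := by
      refine Nat.le_of_mul_le_mul_right (c := n) ?_ hn
      calc s * (b * b) / n * (d * d) * n = s * (b * b) / n * n * (d * d) := by ring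
        _ ≤ s * (b * b) * (d * d) := Nat.mul_le_mul_right _ (Nat.div_mul_le_self _ _)
        _ = s * ((d * b) * (d * b)) := by ring
        _ ≤ s * ((2 * k) * (2 * k)) := Nat.mul_le_mul_left _ (Nat.mul_le_mul hdb hdb)
        _ = 4 * (s * k ^ 2) := by ring
        _ ≤ 4 * n ^ 2 := Nat.mul_le_mul_left _ hsk
        _ = 4 * n * n := by ring
    rw [add_mul, one_mul]
    omega
  · set b := k / d + 1
    -- Rounding `x` down and `k / d` up costs a factor 2 each; squaring gives the 16.
    have hxd : x ≤ 2 * d := by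
      have h1 := Nat.lt_floor_add_one x
      have h2 : (1 : ℝ) ≤ d := by exact_mod_cast hd1
      rw [← hd] at h1
      linarith
    have hbx : (b : ℝ) * x ≤ 4 * k := by
      have h1 : (d : ℝ) * b ≤ 2 * k := by exact_mod_cast hdb
      calc (b : ℝ) * x ≤ b * (2 * d) := by gcongr
        _ = 2 * (d * b) := by ring
        _ ≤ 2 * (2 * k) := by gcongr
        _ = 4 * k := by ring
    have hbx2 : (b : ℝ) * b * x ^ 2 ≤ 16 * k ^ 2 := by
      calc (b : ℝ) * b * x ^ 2 = (b * x) ^ 2 := by ring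
        _ ≤ (4 * (k : ℝ)) ^ 2 := by gcongr
        _ = 16 * (k : ℝ) ^ 2 := by ring
    have hexp : (n : ℝ) ^ (1 - 2 / σ - 2) * (k : ℝ) ^ 2 * (s : ℝ) ^ (1 - (1 - 2 / σ)) =
        k ^ 2 / x ^ 2 / n := by
      rw [hx2, Real.div_rpow hn'.le hs'.le,
        show 1 - 2 / σ - 2 = -(2 / σ) - 1 by ring, show 1 - (1 - 2 / σ) = 2 / σ by ring,
        Real.rpow_sub_one hn'.ne', Real.rpow_neg hn'.le]
      have := (Real.rpow_pos_of_pos hn' (2 / σ)).ne'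
      have := (Real.rpow_pos_of_pos hs' (2 / σ)).ne'
      field_simp
    rw [hexp]
    refine Nat.cast_div_le.trans ?_
    push_cast
    rw [← mul_div_assoc, ← mul_div_assoc]
    gcongr
    rwa [le_div_iff₀ (by positivity)]

/-! ### The main theorem -/

theorem exists_bit_encoding {F : Type u} [Fintype F] {n c : ℕ} (h : Fintype.card F ≤ n ^ c) :
    Nonempty (F ↪ (Fin c → Fin (Nat.clog 2 n) → Bool)) := by
  refine Function.Embedding.nonempty_of_card_le (h.trans ?_)
  simp only [Fintype.card_fun, Fintype.card_bool, Fintype.card_fin]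
  exact Nat.pow_le_pow_left (Nat.le_pow_clog one_lt_two n) c

theorem multiProduct_solvableWithin {F : Type u} [Field F] [Fintype F] {c : ℕ} {K ρ : ℝ}
    (hρ : IsCliqueMMExponent F K ρ) {n k s : ℕ} (hF : Fintype.card F ≤ n ^ c) (hk : 0 < k)
    (hnk : n ≤ k ^ 2) (hsn : s ≤ n) (hsk : s * k ^ 2 ≤ n ^ 2) {LS LT LP : EntryLayout n k s}
    (hLS : LS.Balanced) (hLT : LT.Balanced) (hLP : LP.Balanced) :
    (multiProduct F LS LT LP).SolvableWithin
      (4 * c * (15 + 54 * ⌈K⌉₊) *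
        max 1 ((n : ℝ) ^ (ρ - 2) * (k : ℝ) ^ 2 * (s : ℝ) ^ (1 - ρ))) := by
  obtain ⟨σ, hσ, rfl, hbil⟩ := hρ
  rcases Nat.eq_zero_or_pos s with rfl | hs
  · refine ⟨0, by push_cast; positivity, ?_⟩
    have : Nonempty (multiProduct F LS LT LP).Inst := ⟨(isEmptyElim, isEmptyElim)⟩
    refine Learns.solvableIn (.zero _) fun v X Y _ => ?_
    funext e
    exact e.1.1.elim0
  obtain ⟨e⟩ := exists_bit_encoding hF
  obtain ⟨d, b, h₁, h₂, h₃, h₄⟩ := exists_block_size hσ hs hk hnk hsn hsk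
  obtain ⟨m, hm, ⟨A⟩⟩ := hbil d
  have hsm : s * m ≤ ⌈K⌉₊ * n := by
    have : (s : ℝ) * m ≤ ⌈K⌉₊ * n := by
      calc (s : ℝ) * m ≤ s * (⌈K⌉₊ * (d : ℝ) ^ σ) := by
            gcongr
            exact hm.trans (by gcongr; exact Nat.le_ceil K)
        _ = ⌈K⌉₊ * (s * (d : ℝ) ^ σ) := by ring
        _ ≤ ⌈K⌉₊ * n := by gcongr
    exact_mod_cast this
  refine ⟨_, ?_, multiProduct_solvableIn e A (hs.trans_le hsn) hs h₁ hsm h₃ hLS hLT hLP⟩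
  generalize (n : ℝ) ^ (1 - 2 / σ - 2) * (k : ℝ) ^ 2 * (s : ℝ) ^ (1 - (1 - 2 / σ)) = R at h₄ ⊢
  have hM : R ≤ max 1 R := le_max_right _ _
  have hM' : 1 ≤ max 1 R := le_max_left _ _
  generalize max 1 R = M at hM hM' ⊢
  -- `18 = 16 + 2`, and then `54 = 3 * 18`.
  have h₅ : ((b * b / n : ℕ) : ℝ) + 2 ≤ 18 * M := by linarith
  rw [mul_assoc _ _ M, Nat.cast_mul, Nat.cast_mul, Nat.cast_add, Nat.cast_mul, Nat.cast_mul,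
    Nat.cast_add]
  push_cast at h₅ ⊢
  gcongr
  calc (15 : ℝ) + 3 * (⌈K⌉₊ * (((b * b / n : ℕ) : ℝ) + 2)) ≤ 15 * M + 3 * (⌈K⌉₊ * (18 * M)) := by
        gcongr
        linarith
    _ = (15 + 54 * ⌈K⌉₊) * M := by ring

theorem mainTheorem2 (c : ℕ) (K ρ : ℝ) :
    ∃ C : ℝ, 0 < C ∧
      ∀ (F : Type u) [Field F] [Fintype F], IsCliqueMMExponent F K ρ →
      ∀ n k s : ℕ, Fintype.card F ≤ n ^ c →
        Real.sqrt (n : ℝ) ≤ (k : ℝ) → k ≤ n → (s : ℝ) ≤ ((n : ℝ) / (k : ℝ)) ^ 2 →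
        (∀ (q r : ℕ) (hk : k = r * q * r) (l : Fin n ≃ Fin s × Fin q × Fin q),
          (labelledProduct F hk l).SolvableWithin
            (C * max 1 ((n : ℝ) ^ (ρ - 2) * (k : ℝ) ^ 2 * (s : ℝ) ^ (1 - ρ)))) ∧
        (∀ LS LT LP : EntryLayout n k s, LS.Balanced → LT.Balanced → LP.Balanced →
          (multiProduct F LS LT LP).SolvableWithin
            (C * max 1 ((n : ℝ) ^ (ρ - 2) * (k : ℝ) ^ 2 * (s : ℝ) ^ (1 - ρ)))) := by
  -- The `+ 1` keeps the constant positive when `c = 0`.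
  refine ⟨4 * c * (15 + 54 * ⌈K⌉₊) + 1, by positivity, ?_⟩
  intro F _ _ hρ n k s hF hnk hkn hs
  -- A field has at least two elements, while `0 ^ c ≤ 1`.
  have hn : 0 < n := by
    rcases Nat.eq_zero_or_pos n with rfl | h
    · have h1 : 1 < Fintype.card F := Fintype.one_lt_card
      have h2 : 0 ^ c ≤ 1 := by
        rcases Nat.eq_zero_or_pos c with rfl | hc
        · simp
        · simp [hc.ne']
      omega
    · exact h
  have hn' : (0 : ℝ) < n := by exact_mod_cast hn
  have hk' : (0 : ℝ) < k := (Real.sqrt_pos.2 hn').trans_le hnk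
  have hk : 0 < k := by exact_mod_cast hk'
  have hnk' : n ≤ k ^ 2 := by
    exact_mod_cast (Real.sqrt_le_left hk'.le).1 hnk
  have hsk : s * k ^ 2 ≤ n ^ 2 := by
    rw [div_pow, le_div_iff₀ (by positivity)] at hs
    exact_mod_cast hs
  have hsn : s ≤ n := by
    refine Nat.le_of_mul_le_mul_right (c := n) ?_ hn
    calc s * n ≤ s * k ^ 2 := Nat.mul_le_mul_left _ hnk'
      _ ≤ n * n := by rwa [← sq]
  have main : ∀ LS LT LP : EntryLayout n k s, LS.Balanced → LT.Balanced → LP.Balanced →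
      (multiProduct F LS LT LP).SolvableWithin
        ((4 * c * (15 + 54 * ⌈K⌉₊) + 1) *
          max 1 ((n : ℝ) ^ (ρ - 2) * (k : ℝ) ^ 2 * (s : ℝ) ^ (1 - ρ))) := by
    intro LS LT LP hLS hLT hLP
    obtain ⟨T, hT, h⟩ := multiProduct_solvableWithin hρ hF hk hnk' hsn hsk hLS hLT hLP
    exact ⟨T, hT.trans (by gcongr; linarith), h⟩
  refine ⟨fun q r hqr l => ?_, main⟩
  have hbal := labelLayout_balanced hqr l hsk
  exact main _ _ _ hbal hbal hbal
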